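/- Let $\mathfrak H$ be a complex Hilbert space with inner product $(\cdot,\cdot)$. A fundamental symmetry in $\mathfrak H$ is a bounded operator $J$ on $\mathfrak H$ with $J^2=I$ and $J=J^*$; it is called nontrivial if $J\neq I$ and $J\neq -I$. A densely defined linear operator $A$ in $\mathfrak H$ is called $J$-self-adjoint if it coincides with its adjoint with respect to the indefinite inner product $[x,y]=(Jx,y)$. The resolvent set of $A$ is the set of all $z\in\mathbb C$ for which $A-zI$ has a bounded inverse defined on all of $\mathfrak H$. Let $S$ be a closed, densely defined, symmetric operator in $\mathfrak H$ with deficiency indices $\langle 2,2\rangle$, that is, $\dim\ker(S^*-iI)=\dim\ker(S^*+iI)=2$. Let $J$ and $R$ be fundamental symmetries in $\mathfrak H$ such that $$SJ=JS,\qquad SR=RS,\qquad JR=-RJ .$$ Then for every nontrivial fundamental symmetry $\widetilde J\in\operatorname{span}_{\mathbb C}\{I,J,R,JR\}$ there exists a $\widetilde J$-self-adjoint extension $A\supset S$ with empty resolvent set, $\rho(A)=\emptyset$. -/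

import Mathlib

namespace KreinExt

variable {H : Type*} [NormedAddCommGroup H] [InnerProductSpace ℂ H] [CompleteSpace H]

/-- A fundamental symmetry of the Hilbert space `H`: a bounded operator with
`J ^ 2 = I` and `J = J*`. -/
def IsFundamentalSymmetry (J : H →L[ℂ] H) : Prop :=
  J * J = 1 ∧ ContinuousLinearMap.adjoint J = J

/-- A nontrivial fundamental symmetry: one that is different from `I` and from `-I`. -/
def IsNontrivialFundamentalSymmetry (J : H →L[ℂ] H) : Prop :=
  IsFundamentalSymmetry J ∧ J ≠ 1 ∧ J ≠ -1

/-- The indefinite inner product `[x, y] = (J x, y)`. It is conjugate linear in the first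
variable, as is the inner product of Mathlib. -/
noncomputable def kreinInner (J : H →L[ℂ] H) (x y : H) : ℂ := inner ℂ (J x) y

/-- The operator `A` is `J`-self-adjoint: it is densely defined and coincides with its adjoint
with respect to `[·, ·]`. The graph of that adjoint consists of the pairs `(x, z)` with
`[A y, x] = [y, z]` for all `y` in the domain of `A`. -/
def IsJSelfAdjoint (J : H →L[ℂ] H) (A : H →ₗ.[ℂ] H) : Prop :=
  Dense (A.domain : Set H) ∧
    ∀ x z : H, (x, z) ∈ A.graph ↔
      ∀ y : A.domain, kreinInner J (A y) x = kreinInner J (y : H) z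

/-- The equality `S C = C S` of (partially defined) operators, for a bounded operator `C` defined
on all of `H`: the domain `{x | C x ∈ D(S)}` of `S C` is the domain `D(S)` of `C S`, and the two
operators agree there. -/
def CommutesWith (S : H →ₗ.[ℂ] H) (C : H →L[ℂ] H) : Prop :=
  (∀ x : H, C x ∈ S.domain ↔ x ∈ S.domain) ∧
    ∀ x y : S.domain, (y : H) = C (x : H) → S y = C (S x)

/-- A closed, densely defined, symmetric operator. -/
def IsClosedSymmetric (S : H →ₗ.[ℂ] H) : Prop :=
  S.IsClosed ∧ Dense (S.domain : Set H) ∧ S.IsFormalAdjoint S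

/-- The defect subspace `ker (S* - μ I)`. -/
noncomputable def defectSpace (S : H →ₗ.[ℂ] H) (μ : ℂ) : Submodule ℂ H :=
  (LinearMap.ker (S.adjoint.toFun - μ • S.adjoint.domain.subtype)).map S.adjoint.domain.subtype

/-- The densely defined symmetric operator `S` has the finite deficiency indices `⟨m, n⟩`, where
`m = dim ker (S* - i I)` and `n = dim ker (S* + i I)`. -/
def HasDeficiencyIndices (S : H →ₗ.[ℂ] H) (m n : ℕ) : Prop :=
  Module.rank ℂ (defectSpace S Complex.I) = m ∧
    Module.rank ℂ (defectSpace S (-Complex.I)) = n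

/-- The resolvent set of an operator `A`: all complex `z` for which `A - z I` has a bounded
inverse defined on the whole of `H`. -/
def resolventSet (A : H →ₗ.[ℂ] H) : Set ℂ :=
  {z | ∃ B : H →L[ℂ] H,
    (∀ y : H, ∃ h : B y ∈ A.domain, A ⟨B y, h⟩ - z • B y = y) ∧
      ∀ x : A.domain, B (A x - z • (x : H)) = (x : H)}

/-- The complex Clifford algebra spanned by `I`, `J`, `R` and `J R`. -/
def cliffordSpan (J R : H →L[ℂ] H) : Submodule ℂ (H →L[ℂ] H) :=
  Submodule.span ℂ {1, J, R, J * R}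

end KreinExt

/-!
The span of `I, J, R, JR` contains a projection `P` with `J' P = (I - P) J'`, and `P` commutes with
`S`. Writing `H = ker P ⊕ ran P`, the operator `A` acts as `S†` on `ker P` and as `S` on `ran P`;
since `J'` interchanges the two summands, `A` is `J'`-self-adjoint. If `f` is an eigenvector of
`S†`, then `f` (when `P f = 0`) or `J' P f` is an eigenvector of `A` for the same eigenvalue, so `A`
has all the eigenvalues of `S†`. As `S` is not self-adjoint, every nonreal `μ` or its conjugate is
an eigenvalue of `S†`, and neither an eigenvalue of the `J'`-self-adjoint `A` nor its conjugate lies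
in `ρ(A)`. Thus `ρ(A)` is open in the complex plane and contained in the real line, hence empty.
-/

namespace KreinExt

open Complex ComplexConjugate InnerProductSpace

section Clifford

variable {K A : Type*} [Ring A] {J R : A}

section CommRing

variable [CommRing K] [Algebra K A]

theorem traceless_mul_traceless (hJ : J * J = 1) (hR : R * R = 1) (hJR : J * R = -(R * J))
    (b c d b' c' d' : K) :
    (b • J + c • R + d • (J * R)) * (b' • J + c' • R + d' • (J * R)) =
      (b * b' + c * c' - d * d') • (1 : A) + (d * c' - c * d') • J + (b * d' - d * b') • R +
        (b * c' - c * b') • (J * R) := by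
  have hRJ : R * J = -(J * R) := by rw [hJR, neg_neg]
  have hJJ (x : A) : J * (J * x) = x := by rw [← mul_assoc, hJ, one_mul]
  have hRJx (x : A) : R * (J * x) = -(J * (R * x)) := by
    rw [← mul_assoc, hRJ, neg_mul, mul_assoc]
  simp only [mul_add, add_mul, mul_smul_comm, smul_mul_assoc, mul_one, mul_assoc, hJ, hR, hRJ, hJJ,
    hRJx, mul_neg]
  module

theorem traceless_mul_self (hJ : J * J = 1) (hR : R * R = 1) (hJR : J * R = -(R * J))
    (b c d : K) :
    (b • J + c • R + d • (J * R)) * (b • J + c • R + d • (J * R)) =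
      (b ^ 2 + c ^ 2 - d ^ 2) • (1 : A) := by
  rw [traceless_mul_traceless hJ hR hJR]
  module

theorem traceless_mul_add_mul_traceless (hJ : J * J = 1) (hR : R * R = 1)
    (hJR : J * R = -(R * J)) (b c d b' c' d' : K) :
    (b • J + c • R + d • (J * R)) * (b' • J + c' • R + d' • (J * R)) +
      (b' • J + c' • R + d' • (J * R)) * (b • J + c • R + d • (J * R)) =
      (2 * (b * b' + c * c' - d * d')) • (1 : A) := by
  rw [traceless_mul_traceless hJ hR hJR, traceless_mul_traceless hJ hR hJR]
  module

end CommRing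

variable [Field K] [Algebra K A]

theorem eq_one_or_eq_neg_one_of_smul_one_mul_self {t : K}
    (h : (t • (1 : A)) * (t • (1 : A)) = 1) : t • (1 : A) = 1 ∨ t • (1 : A) = -1 := by
  have hfactor : ((t - 1) * (t + 1)) • (1 : A) = 0 := by
    rw [smul_mul_smul_comm, one_mul] at h
    linear_combination (norm := module) h
  rcases smul_eq_zero.mp hfactor with ht | hA
  · rcases mul_eq_zero.mp ht with ht | ht
    · exact .inl (by rw [sub_eq_zero.mp ht, one_smul])
    · exact .inr (by rw [eq_neg_of_add_eq_zero_left ht, neg_smul, one_smul])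
  · exact .inl (by rw [hA, smul_zero])

theorem exists_traceless_of_mul_self_eq_one [NeZero (2 : K)] (hJ : J * J = 1) (hR : R * R = 1)
    (hJR : J * R = -(R * J)) {T : A} (hT : T ∈ Submodule.span K {1, J, R, J * R})
    (hT2 : T * T = 1) (hT1 : T ≠ 1) (hTn : T ≠ -1) :
    ∃ b c d : K, T = b • J + c • R + d • (J * R) := by
  simp only [Submodule.mem_span_insert, Submodule.mem_span_singleton] at hT
  obtain ⟨a, _, ⟨b, _, ⟨c, _, ⟨d, rfl⟩, rfl⟩, rfl⟩, rfl⟩ := hT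
  obtain ⟨V, hV⟩ : ∃ V, V = b • J + c • R + d • (J * R) := ⟨_, rfl⟩
  obtain ⟨s, hs⟩ : ∃ s : K, V * V = s • (1 : A) := ⟨_, hV ▸ traceless_mul_self hJ hR hJR b c d⟩
  rw [← add_assoc (b • J), ← hV] at hT2 hT1 hTn ⊢
  suffices ha : a = 0 from ⟨b, c, d, by rw [ha, zero_smul, zero_add, hV]⟩
  by_contra ha
  have h2a : 2 * a ≠ 0 := mul_ne_zero two_ne_zero ha
  -- The square of `a + V` is `a² + s + 2 a V`, so for `a ≠ 0` the element `V` is a scalar.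
  obtain ⟨t, rfl⟩ : ∃ t : K, V = t • (1 : A) := by
    refine ⟨(2 * a)⁻¹ * (1 - a ^ 2 - s), ?_⟩
    have hlin : (2 * a) • V = (1 - a ^ 2 - s) • (1 : A) := by
      simp only [mul_add, add_mul, mul_smul_comm, smul_mul_assoc, mul_one, one_mul, hs] at hT2
      linear_combination (norm := module) hT2
    rw [mul_smul, ← hlin, inv_smul_smul₀ h2a]
  rw [← add_smul] at hT2 hT1 hTn
  exact (eq_one_or_eq_neg_one_of_smul_one_mul_self hT2).elim hT1 hTn

end Clifford

section StarClifford

variable {A : Type*} [Ring A] [StarRing A] [Algebra ℂ A] [StarModule ℂ A] {J R T : A}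

theorem exists_real_coeff_of_isSelfAdjoint (sJ : IsSelfAdjoint J) (sR : IsSelfAdjoint R)
    (hJR : J * R = -(R * J)) {b c d : ℂ}
    (hT : IsSelfAdjoint (b • J + c • R + d • (J * R))) :
    ∃ d' : ℂ, b • J + c • R + d • (J * R) = (b.re : ℂ) • J + (c.re : ℂ) • R + d' • (J * R) := by
  have hstar : conj b • J + conj c • R - conj d • (J * R) = b • J + c • R + d • (J * R) := by
    simpa [star_add, star_smul, star_mul, sJ.star_eq, sR.star_eq, hJR, ← sub_eq_add_neg]
      using hT.star_eq
  refine ⟨(d - conj d) / 2, ?_⟩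
  rw [re_eq_add_conj, re_eq_add_conj]
  linear_combination (norm := module) (-(1 / 2) : ℂ) • hstar

theorem exists_unit_orthogonal (p q : ℝ) : ∃ u v : ℝ, u ^ 2 + v ^ 2 = 1 ∧ p * u + q * v = 0 := by
  refine ⟨-Real.sin (arg ⟨p, q⟩), Real.cos (arg ⟨p, q⟩), by simp, ?_⟩
  have hp : ‖(⟨p, q⟩ : ℂ)‖ * Real.cos (arg ⟨p, q⟩) = p := norm_mul_cos_arg _
  have hq : ‖(⟨p, q⟩ : ℂ)‖ * Real.sin (arg ⟨p, q⟩) = q := norm_mul_sin_arg _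
  linear_combination Real.sin (arg ⟨p, q⟩) * hp - Real.cos (arg ⟨p, q⟩) * hq

theorem exists_anticommuting_symmetry (hJ : J * J = 1) (hR : R * R = 1) (sJ : IsSelfAdjoint J)
    (sR : IsSelfAdjoint R) (hJR : J * R = -(R * J))
    (hT : T ∈ Submodule.span ℂ {1, J, R, J * R}) (hT2 : T * T = 1) (sT : IsSelfAdjoint T)
    (hT1 : T ≠ 1) (hTn : T ≠ -1) :
    ∃ Q ∈ Submodule.span ℂ {J, R}, Q * Q = 1 ∧ IsSelfAdjoint Q ∧ T * Q = -(Q * T) := by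
  obtain ⟨b, c, d, rfl⟩ := exists_traceless_of_mul_self_eq_one hJ hR hJR hT hT2 hT1 hTn
  obtain ⟨d', hreal⟩ := exists_real_coeff_of_isSelfAdjoint sJ sR hJR sT
  obtain ⟨u, v, huv, horth⟩ := exists_unit_orthogonal b.re c.re
  rw [hreal]
  refine ⟨(u : ℂ) • J + (v : ℂ) • R, Submodule.mem_span_pair.mpr ⟨u, v, rfl⟩, ?_, ?_, ?_⟩
  · have huv' : (u : ℂ) ^ 2 + (v : ℂ) ^ 2 = 1 := mod_cast huv
    simpa [huv'] using traceless_mul_self hJ hR hJR (u : ℂ) v 0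
  · exact (IsSelfAdjoint.smul (conj_ofReal u) sJ).add (IsSelfAdjoint.smul (conj_ofReal v) sR)
  · have horth' : (b.re : ℂ) * u + c.re * v = 0 := mod_cast horth
    have hanti := traceless_mul_add_mul_traceless hJ hR hJR (b.re : ℂ) c.re d' u v 0
    rw [mul_zero, sub_zero, horth', mul_zero, zero_smul, zero_smul, add_zero] at hanti
    exact eq_neg_of_add_eq_zero_left hanti

theorem isStarProjection_half_one_sub {Q : A} (hQ : Q * Q = 1) (sQ : IsSelfAdjoint Q) :
    IsStarProjection ((1 / 2 : ℂ) • (1 - Q)) where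
  isIdempotentElem := by
    rw [IsIdempotentElem, smul_mul_smul_comm, mul_sub, sub_mul, sub_mul, hQ, one_mul, mul_one,
      one_mul]
    module
  isSelfAdjoint := IsSelfAdjoint.smul (by simp [IsSelfAdjoint]) ((IsSelfAdjoint.one A).sub sQ)

theorem exists_interchanged_projection (hJ : J * J = 1) (hR : R * R = 1) (sJ : IsSelfAdjoint J)
    (sR : IsSelfAdjoint R) (hJR : J * R = -(R * J))
    (hT : T ∈ Submodule.span ℂ {1, J, R, J * R}) (hT2 : T * T = 1) (sT : IsSelfAdjoint T)
    (hT1 : T ≠ 1) (hTn : T ≠ -1) :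
    ∃ P ∈ Submodule.span ℂ {1, J, R, J * R}, IsStarProjection P ∧ T * P = (1 - P) * T := by
  obtain ⟨Q, hQ, hQ2, sQ, hTQ⟩ :=
    exists_anticommuting_symmetry hJ hR sJ sR hJR hT hT2 sT hT1 hTn
  have hQ' : Q ∈ Submodule.span ℂ {1, J, R, J * R} :=
    Submodule.span_mono (by grind) hQ
  refine ⟨(1 / 2 : ℂ) • (1 - Q), Submodule.smul_mem _ _ (Submodule.sub_mem _
    (Submodule.subset_span (by simp)) hQ'), isStarProjection_half_one_sub hQ2 sQ, ?_⟩
  rw [mul_smul_comm, mul_sub, mul_one, hTQ, sub_mul, smul_mul_assoc, sub_mul, one_mul]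
  module

end StarClifford

section LinearRelation

variable {𝕜 E F : Type*} [RCLike 𝕜] [NormedAddCommGroup E] [InnerProductSpace 𝕜 E]
  [NormedAddCommGroup F] [InnerProductSpace 𝕜 F]

theorem adjoint_adjoint_of_isClosed [CompleteSpace E] [CompleteSpace F]
    {g : Submodule 𝕜 (E × F)} (hg : IsClosed (g : Set (E × F))) : g.adjoint.adjoint = g := by
  let e := WithLp.prodContinuousLinearEquiv 2 𝕜 E F
  let G : Submodule 𝕜 (WithLp 2 (E × F)) := g.comap (e : WithLp 2 (E × F) →ₗ[𝕜] E × F)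
  have hG : IsClosed (G : Set (WithLp 2 (E × F))) := hg.preimage e.continuous
  have : CompleteSpace G := hG.completeSpace_coe
  refine le_antisymm (fun ⟨x, z⟩ hxz => ?_) fun ⟨x, z⟩ hxz => ?_
  · refine (Submodule.mem_adjoint_iff _ _).mpr fun a b hab => ?_
    have hpair := (Submodule.mem_adjoint_iff _ _).mp hab _ _ hxz
    rw [sub_eq_zero] at hpair ⊢
    rw [← inner_conj_symm b, ← inner_conj_symm a, hpair]
  · suffices h : WithLp.toLp 2 (x, z) ∈ Gᗮᗮ by
      rwa [Submodule.orthogonal_orthogonal] at h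
    refine (Submodule.mem_orthogonal _ _).mpr fun w hw => ?_
    have hw' : (w.snd, -w.fst) ∈ g.adjoint := by
      refine (Submodule.mem_adjoint_iff _ _).mpr fun a b hab => ?_
      have horth : inner 𝕜 (WithLp.toLp 2 (a, b)) w = 0 :=
        (Submodule.mem_orthogonal _ _).mp hw _ hab
      rw [WithLp.prod_inner_apply] at horth
      rw [inner_neg_right, sub_neg_eq_add, add_comm]
      exact horth
    have hpair := (Submodule.mem_adjoint_iff _ _).mp hxz _ _ hw'
    rw [inner_neg_left, ← neg_add', neg_eq_zero] at hpair
    rw [WithLp.prod_inner_apply]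
    exact hpair

/-- The algebra of all bounded operators `C` for which `C × C` maps the linear relation `g` into
itself. For the graph of an operator `S` this is the inclusion `C S ⊆ S C`. -/
def relationStabilizer (g : Submodule 𝕜 (E × E)) : Subalgebra 𝕜 (E →L[𝕜] E) where
  carrier := {C | ∀ x z, (x, z) ∈ g → (C x, C z) ∈ g}
  mul_mem' hC hD x z h := hC _ _ (hD x z h)
  add_mem' hC hD x z h := g.add_mem (hC x z h) (hD x z h)
  algebraMap_mem' a _ _ h := g.smul_mem a h

theorem adjoint_mem_relationStabilizer [CompleteSpace E] {g : Submodule 𝕜 (E × E)}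
    {C : E →L[𝕜] E} (hC : C ∈ relationStabilizer g) :
    C.adjoint ∈ relationStabilizer g.adjoint := by
  intro x z hxz
  rw [Submodule.mem_adjoint_iff] at hxz ⊢
  intro a b hab
  simp only [ContinuousLinearMap.adjoint_inner_right]
  exact hxz _ _ (hC a b hab)

end LinearRelation

variable {H : Type*} [NormedAddCommGroup H] [InnerProductSpace ℂ H]

theorem CommutesWith.mem_relationStabilizer {S : H →ₗ.[ℂ] H} {C : H →L[ℂ] H}
    (h : CommutesWith S C) : C ∈ relationStabilizer S.graph := by
  intro x z hxz
  obtain ⟨y, rfl, rfl⟩ := (LinearPMap.mem_graph_iff S).mp hxz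
  have hCy : C y ∈ S.domain := (h.1 y).mpr y.2
  exact h.2 y ⟨C y, hCy⟩ rfl ▸ S.mem_graph ⟨C y, hCy⟩

theorem cliffordSpan_le_relationStabilizer {S : H →ₗ.[ℂ] H} {J R : H →L[ℂ] H}
    (hJ : CommutesWith S J) (hR : CommutesWith S R) :
    cliffordSpan J R ≤ (relationStabilizer S.graph).toSubmodule := by
  have hJ' := hJ.mem_relationStabilizer
  have hR' := hR.mem_relationStabilizer
  rw [cliffordSpan, Submodule.span_le]
  rintro _ (rfl | rfl | rfl | rfl)
  exacts [(relationStabilizer S.graph).one_mem, hJ', hR',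
    (relationStabilizer S.graph).mul_mem hJ' hR']

section Spectrum

variable {A : H →ₗ.[ℂ] H}

/-- The set of eigenvalues of a partially defined operator. -/
def pointSpectrum (A : H →ₗ.[ℂ] H) : Set ℂ :=
  {μ | ∃ f : H, f ≠ 0 ∧ (f, μ • f) ∈ A.graph}

theorem mem_resolventSet_iff {z : ℂ} : z ∈ resolventSet A ↔ ∃ B : H →L[ℂ] H,
    (∀ y, (B y, y + z • B y) ∈ A.graph) ∧ ∀ x w, (x, w) ∈ A.graph → B (w - z • x) = x := by
  refine exists_congr fun B => and_congr (forall_congr' fun y => ?_)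
    ⟨fun h x w hxw => ?_, fun h x => h _ _ (A.mem_graph x)⟩
  · simp [LinearPMap.mem_graph_iff, sub_eq_iff_eq_add]
  · obtain ⟨x, rfl, rfl⟩ := (LinearPMap.mem_graph_iff A).mp hxw
    exact h x

theorem notMem_resolventSet_of_mem_pointSpectrum {μ : ℂ} (hμ : μ ∈ pointSpectrum A) :
    μ ∉ resolventSet A := by
  obtain ⟨f, hf0, hf⟩ := hμ
  intro hres
  obtain ⟨B, -, hB⟩ := mem_resolventSet_iff.mp hres
  exact hf0 (by simpa using (hB _ _ hf).symm)

theorem isOpen_resolventSet [CompleteSpace H] (A : H →ₗ.[ℂ] H) : IsOpen (resolventSet A) := by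
  refine isOpen_iff_mem_nhds.mpr fun z hz => ?_
  obtain ⟨B, hBright, hBleft⟩ := mem_resolventSet_iff.mp hz
  have hunits : {w : ℂ | IsUnit (1 - (w - z) • B)} ∈ nhds z :=
    (Units.isOpen.preimage (by fun_prop : Continuous fun w : ℂ => 1 - (w - z) • B)).mem_nhds
      (by simp)
  filter_upwards [hunits] with w ⟨U, hU⟩
  have hU_apply (v : H) : (U : H →L[ℂ] H) v = v - (w - z) • B v := by simp [hU]
  have hUinv (v : H) : (U : H →L[ℂ] H) ((↑U⁻¹ : H →L[ℂ] H) v) = v :=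
    DFunLike.congr_fun U.mul_inv v
  have hinvU (v : H) : (↑U⁻¹ : H →L[ℂ] H) ((U : H →L[ℂ] H) v) = v :=
    DFunLike.congr_fun U.inv_mul v
  -- The resolvent at `w` is `B (1 - (w - z) B)⁻¹`.
  refine mem_resolventSet_iff.mpr ⟨B * ↑U⁻¹, fun y => ?_, fun x v hxv => ?_⟩
  · have hy : y + w • B ((↑U⁻¹ : H →L[ℂ] H) y) =
        (↑U⁻¹ : H →L[ℂ] H) y + z • B ((↑U⁻¹ : H →L[ℂ] H) y) := by
      linear_combination (norm := module) hU_apply ((↑U⁻¹ : H →L[ℂ] H) y) - hUinv y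
    rw [mul_apply_eq_comp, hy]
    exact hBright _
  · have hv : v - w • x = (U : H →L[ℂ] H) (v - z • x) := by
      rw [hU_apply, hBleft x v hxv]
      module
    rw [mul_apply_eq_comp, hv, hinvU, hBleft x v hxv]

theorem isJSelfAdjoint_iff {J : H →L[ℂ] H} : IsJSelfAdjoint J A ↔
    Dense (A.domain : Set H) ∧ ∀ x z, (x, z) ∈ A.graph ↔
      ∀ y w, (y, w) ∈ A.graph → ⟪J w, x⟫_ℂ = ⟪J y, z⟫_ℂ := by
  refine and_congr_right' (forall₂_congr fun x z => iff_congr Iff.rfl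
    ⟨fun h y w hyw => ?_, fun h y => h _ _ (A.mem_graph y)⟩)
  obtain ⟨y, rfl, rfl⟩ := (LinearPMap.mem_graph_iff A).mp hyw
  exact h y

/-- If `A f = μ f`, then `J f` is orthogonal to the range of `J (A - μ̄)`. -/
theorem IsJSelfAdjoint.conj_notMem_resolventSet {J : H →L[ℂ] H} (hJ : J * J = 1)
    (hA : IsJSelfAdjoint J A) {μ : ℂ} (hμ : μ ∈ pointSpectrum A) : conj μ ∉ resolventSet A := by
  obtain ⟨f, hf0, hf⟩ := hμ
  intro hres
  obtain ⟨B, hB, -⟩ := mem_resolventSet_iff.mp hres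
  have horth (u : H) : ⟪J u, f⟫_ℂ = 0 := by
    have h := ((isJSelfAdjoint_iff.mp hA).2 _ _).mp hf _ _ (hB u)
    simp only [map_add, map_smul, inner_add_left, inner_smul_left, inner_smul_right, conj_conj] at h
    linear_combination h
  have hJf : J (J f) = f := DFunLike.congr_fun hJ f
  exact hf0 (inner_self_eq_zero.mp (hJf ▸ horth (J f)))

theorem IsJSelfAdjoint.resolventSet_eq_empty [CompleteSpace H] {J : H →L[ℂ] H} (hJ : J * J = 1)
    (hA : IsJSelfAdjoint J A)
    (hspec : ∀ μ : ℂ, μ.im ≠ 0 → μ ∈ pointSpectrum A ∨ conj μ ∈ pointSpectrum A) :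
    resolventSet A = ∅ := by
  have hnonreal (μ : ℂ) (hμ : μ.im ≠ 0) : μ ∉ resolventSet A := by
    rcases hspec μ hμ with h | h
    · exact notMem_resolventSet_of_mem_pointSpectrum h
    · simpa using hA.conj_notMem_resolventSet hJ h
  have hdense : Dense {μ : ℂ | μ.im ≠ 0} := (dense_compl_singleton (0 : ℝ)).preimage isOpenMap_im
  by_contra hne
  obtain ⟨μ, hμres, hμ⟩ :=
    hdense.inter_open_nonempty _ (isOpen_resolventSet A) (Set.nonempty_iff_ne_empty.mpr hne)
  exact hnonreal μ hμ hμres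

end Spectrum

section Symmetric

variable {S : H →ₗ.[ℂ] H}

theorem abs_im_mul_norm_le (hS : S.IsFormalAdjoint S) (μ : ℂ) {x z : H}
    (hxz : (x, z) ∈ S.graph) : |μ.im| * ‖x‖ ≤ ‖z - μ • x‖ := by
  obtain ⟨x, rfl, rfl⟩ := (LinearPMap.mem_graph_iff S).mp hxz
  rcases eq_or_ne (x : H) 0 with hx | hx
  · simp [hx]
  have hreal : (⟪(x : H), S x⟫_ℂ).im = 0 := by
    rw [← conj_eq_iff_im, inner_conj_symm]
    exact hS x x
  have him : (⟪(x : H), S x - μ • (x : H)⟫_ℂ).im = -(μ.im * ‖(x : H)‖ ^ 2) := by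
    rw [inner_sub_right, inner_smul_right, sub_im, hreal, inner_self_eq_norm_sq_to_K]
    simp [mul_im, ← ofReal_pow]
  refine le_of_mul_le_mul_left ?_ (norm_pos_iff.mpr hx)
  calc ‖(x : H)‖ * (|μ.im| * ‖(x : H)‖) = |(⟪(x : H), S x - μ • (x : H)⟫_ℂ).im| := by
        rw [him, abs_neg, abs_mul, abs_of_nonneg (sq_nonneg ‖(x : H)‖)]
        ring
    _ ≤ ‖⟪(x : H), S x - μ • (x : H)⟫_ℂ‖ := abs_im_le_norm _
    _ ≤ ‖(x : H)‖ * ‖S x - μ • (x : H)‖ := norm_inner_le_norm _ _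

theorem notMem_pointSpectrum_of_im_ne_zero (hS : S.IsFormalAdjoint S) {μ : ℂ} (hμ : μ.im ≠ 0) :
    μ ∉ pointSpectrum S := by
  rintro ⟨f, hf0, hf⟩
  have hbound := abs_im_mul_norm_le hS μ hf
  rw [sub_self, norm_zero] at hbound
  exact hbound.not_gt (mul_pos (abs_pos.mpr hμ) (norm_pos_iff.mpr hf0))

/-- The range of `S - μ I`. -/
def shiftedRange (S : H →ₗ.[ℂ] H) (μ : ℂ) : Submodule ℂ H :=
  S.graph.map (LinearMap.snd ℂ H H - μ • LinearMap.fst ℂ H H)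

theorem isClosed_shiftedRange [CompleteSpace H] (hS : S.IsFormalAdjoint S) (hc : S.IsClosed)
    {μ : ℂ} (hμ : μ.im ≠ 0) : IsClosed (shiftedRange S μ : Set H) := by
  let T : S.graph →L[ℂ] H :=
    (ContinuousLinearMap.snd ℂ H H - μ • ContinuousLinearMap.fst ℂ H H).comp S.graph.subtypeL
  have him : 0 < |μ.im| := abs_pos.mpr hμ
  have hT : AntilipschitzWith (Real.toNNReal (|μ.im|⁻¹ + (1 + ‖μ‖ * |μ.im|⁻¹))) T := by
    refine T.antilipschitz_of_bound fun ⟨⟨x, z⟩, hxz⟩ => ?_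
    change max ‖x‖ ‖z‖ ≤ _ * ‖z - μ • x‖
    have hx : ‖x‖ ≤ |μ.im|⁻¹ * ‖z - μ • x‖ :=
      (le_inv_mul_iff₀ him).mpr (abs_im_mul_norm_le hS μ hxz)
    have hz : ‖z‖ ≤ (1 + ‖μ‖ * |μ.im|⁻¹) * ‖z - μ • x‖ := calc
      ‖z‖ = ‖(z - μ • x) + μ • x‖ := by rw [sub_add_cancel]
      _ ≤ ‖z - μ • x‖ + ‖μ‖ * ‖x‖ := (norm_add_le _ _).trans_eq (by rw [norm_smul])
      _ ≤ ‖z - μ • x‖ + ‖μ‖ * (|μ.im|⁻¹ * ‖z - μ • x‖) := by gcongr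
      _ = (1 + ‖μ‖ * |μ.im|⁻¹) * ‖z - μ • x‖ := by ring
    rw [Real.coe_toNNReal _ (by positivity), add_mul]
    exact max_le (hx.trans (le_add_of_nonneg_right (by positivity)))
      (hz.trans (le_add_of_nonneg_left (by positivity)))
  have hgraph : IsClosed (S.graph : Set (H × H)) := hc
  have : CompleteSpace S.graph := hgraph.completeSpace_coe
  have hrange : (shiftedRange S μ : Set H) = Set.range T := by
    ext y
    simp [shiftedRange, T]
  rw [hrange]
  exact hT.isClosed_range T.uniformContinuous

variable [CompleteSpace H]

theorem mem_shiftedRange_orthogonal_iff (hd : Dense (S.domain : Set H)) {μ : ℂ} {f : H} :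
    f ∈ (shiftedRange S μ)ᗮ ↔ (f, conj μ • f) ∈ S.adjoint.graph := by
  rw [LinearPMap.adjoint_graph_eq_graph_adjoint hd, Submodule.mem_adjoint_iff,
    Submodule.mem_orthogonal]
  constructor
  · intro h a b hab
    have hinner : ⟪b - μ • a, f⟫_ℂ = 0 := h _ ⟨(a, b), hab, rfl⟩
    rwa [inner_sub_left, inner_smul_left, ← inner_smul_right] at hinner
  · rintro h _ ⟨⟨a, b⟩, hab, rfl⟩
    change ⟪b - μ • a, f⟫_ℂ = 0
    rw [inner_sub_left, inner_smul_left, ← inner_smul_right]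
    exact h a b hab

theorem shiftedRange_eq_top (hS : IsClosedSymmetric S) {μ : ℂ} (hμ : μ.im ≠ 0)
    (hspec : conj μ ∉ pointSpectrum S.adjoint) : shiftedRange S μ = ⊤ := by
  have : CompleteSpace (shiftedRange S μ) :=
    (isClosed_shiftedRange hS.2.2 hS.1 hμ).completeSpace_coe
  rw [← Submodule.orthogonal_eq_bot_iff, Submodule.eq_bot_iff]
  intro f hf
  by_contra hf0
  exact hspec ⟨f, hf0, (mem_shiftedRange_orthogonal_iff hS.2.1).mp hf⟩

theorem isSelfAdjoint_of_notMem_pointSpectrum_adjoint (hS : IsClosedSymmetric S) {μ : ℂ}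
    (hμ : μ.im ≠ 0) (h : μ ∉ pointSpectrum S.adjoint)
    (hconj : conj μ ∉ pointSpectrum S.adjoint) : IsSelfAdjoint S := by
  have hle : S ≤ S.adjoint := hS.2.2.le_adjoint hS.2.1
  refine LinearPMap.isSelfAdjoint_def.mpr (le_antisymm (LinearPMap.le_of_le_graph ?_) hle)
  rintro ⟨x, z⟩ hxz
  obtain ⟨⟨y, w⟩, hyw, hshift⟩ : z - μ • x ∈ shiftedRange S μ :=
    shiftedRange_eq_top hS hμ hconj ▸ Submodule.mem_top
  have hdiff : (x - y, μ • (x - y)) ∈ S.adjoint.graph := by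
    have hzw : z - w = μ • (x - y) := by
      change w - μ • y = z - μ • x at hshift
      linear_combination (norm := module) -hshift
    exact hzw ▸ S.adjoint.graph.sub_mem hxz (LinearPMap.le_graph_of_le hle hyw)
  have hxy : x = y := by
    by_contra hne
    exact h ⟨x - y, sub_ne_zero.mpr hne, hdiff⟩
  subst hxy
  rwa [LinearPMap.mem_graph_snd_inj _ hxz (LinearPMap.le_graph_of_le hle hyw) rfl]

theorem defectSpace_eq_bot_of_isSelfAdjoint (hS : IsSelfAdjoint S) {μ : ℂ} (hμ : μ.im ≠ 0) :
    defectSpace S μ = ⊥ := by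
  have hadj : S.adjoint = S := LinearPMap.isSelfAdjoint_def.mp hS
  have hsymm : S.IsFormalAdjoint S := by
    simpa only [hadj] using LinearPMap.adjoint_isFormalAdjoint hS.dense_domain
  refine (Submodule.eq_bot_iff _).mpr ?_
  rintro _ ⟨f, hf, rfl⟩
  by_contra hf0
  have heigen : S.adjoint f = μ • (f : H) := sub_eq_zero.mp hf
  exact notMem_pointSpectrum_of_im_ne_zero hsymm hμ
    ⟨f, hf0, by simpa only [hadj, heigen] using S.adjoint.mem_graph f⟩

theorem HasDeficiencyIndices.not_isSelfAdjoint {m n : ℕ} (h : HasDeficiencyIndices S m n)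
    (hmn : m ≠ 0 ∨ n ≠ 0) : ¬IsSelfAdjoint S := by
  intro hS
  rcases hmn with hm | hn
  · refine hm (Nat.cast_injective (R := Cardinal) ?_)
    rw [← h.1, defectSpace_eq_bot_of_isSelfAdjoint hS (by simp), rank_bot, Nat.cast_zero]
  · refine hn (Nat.cast_injective (R := Cardinal) ?_)
    rw [← h.2, defectSpace_eq_bot_of_isSelfAdjoint hS (by simp), rank_bot, Nat.cast_zero]

end Symmetric

section Extension

variable [CompleteSpace H] {S : H →ₗ.[ℂ] H} {J P : H →L[ℂ] H}

/-- The restriction of `S†` to the vectors whose component in the range of the projection `P` lies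
in the domain of `S`. If `P` commutes with `S`, this is the orthogonal sum of the part of `S†` in
`ker P` and the part of `S` in `ran P`. -/
noncomputable def mixedExtension (S : H →ₗ.[ℂ] H) (P : H →L[ℂ] H) : H →ₗ.[ℂ] H :=
  (S.adjoint.graph ⊓ S.graph.comap (P.prodMap P : H × H →ₗ[ℂ] H × H)).toLinearPMap

theorem mem_mixedExtension_graph {x z : H} : (x, z) ∈ (mixedExtension S P).graph ↔
    (x, z) ∈ S.adjoint.graph ∧ (P x, P z) ∈ S.graph := by
  rw [mixedExtension, Submodule.toLinearPMap_graph_eq _ fun x hx hx0 =>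
    S.adjoint.graph_fst_eq_zero_snd (Submodule.mem_inf.mp hx).1 hx0]
  rfl

theorem le_mixedExtension (hd : Dense (S.domain : Set H)) (hS : S.IsFormalAdjoint S)
    (hP : P ∈ relationStabilizer S.graph) : S ≤ mixedExtension S P :=
  LinearPMap.le_of_le_graph fun ⟨x, z⟩ hxz => mem_mixedExtension_graph.mpr
    ⟨LinearPMap.le_graph_of_le (hS.le_adjoint hd) hxz, hP x z hxz⟩

theorem mem_relationStabilizer_adjoint_graph (hd : Dense (S.domain : Set H)) {C : H →L[ℂ] H}
    (hC : C ∈ relationStabilizer S.graph) (sC : IsSelfAdjoint C) :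
    C ∈ relationStabilizer S.adjoint.graph := by
  rw [LinearPMap.adjoint_graph_eq_graph_adjoint hd]
  simpa only [sC.adjoint_eq] using adjoint_mem_relationStabilizer hC

theorem inner_eq_inner_of_mem_adjoint_graph (hd : Dense (S.domain : Set H)) {x z a b : H}
    (hxz : (x, z) ∈ S.adjoint.graph) (hab : (a, b) ∈ S.graph) : ⟪b, x⟫_ℂ = ⟪a, z⟫_ℂ := by
  rw [LinearPMap.adjoint_graph_eq_graph_adjoint hd, Submodule.mem_adjoint_iff] at hxz
  exact sub_eq_zero.mp (hxz a b hab)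

theorem kreinInner_eq_of_mem_mixedExtension_graph (hd : Dense (S.domain : Set H))
    (sJ : IsSelfAdjoint J) (sP : IsSelfAdjoint P) (hSJ : J ∈ relationStabilizer S.graph)
    (hJP : J * P = (1 - P) * J) {x z y w : H} (hxz : (x, z) ∈ (mixedExtension S P).graph)
    (hyw : (y, w) ∈ (mixedExtension S P).graph) : kreinInner J w x = kreinInner J y z := by
  rw [mem_mixedExtension_graph] at hxz hyw
  have hJP_apply (v : H) : J (P v) = J v - P (J v) := DFunLike.congr_fun hJP v
  have hsymm (u v : H) : ⟪P u, v⟫_ℂ = ⟪u, P v⟫_ℂ := sP.isSymmetric u v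
  have hran : ⟪J w, P x⟫_ℂ = ⟪J y, P z⟫_ℂ := by
    have hadj : (J y, J w) ∈ S.adjoint.graph :=
      mem_relationStabilizer_adjoint_graph hd hSJ sJ _ _ hyw.1
    rw [← inner_conj_symm, ← inner_conj_symm (J y),
      inner_eq_inner_of_mem_adjoint_graph hd hadj hxz.2]
  have hker : ⟪J w - P (J w), x⟫_ℂ = ⟪J y - P (J y), z⟫_ℂ := by
    have h := inner_eq_inner_of_mem_adjoint_graph hd hxz.1 (hSJ _ _ hyw.2)
    rwa [hJP_apply, hJP_apply] at h
  simp only [inner_sub_left, hsymm] at hker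
  rw [kreinInner, kreinInner]
  linear_combination hker + hran

theorem interchanged_mem_mixedExtension_graph (hd : Dense (S.domain : Set H))
    (sJ : IsSelfAdjoint J) (hP : IsStarProjection P) (hSJ : J ∈ relationStabilizer S.graph)
    (hSP : P ∈ relationStabilizer S.graph) (hJP : J * P = (1 - P) * J) {g k : H}
    (hgk : (g, k) ∈ S.adjoint.graph) :
    (J (P g), J (P k)) ∈ (mixedExtension S P).graph := by
  have hPJP (v : H) : P (J (P v)) = 0 := by
    have h : P * (J * P) = 0 := by
      rw [hJP, ← mul_assoc, hP.mul_one_sub_self, zero_mul]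
    exact DFunLike.congr_fun h v
  refine mem_mixedExtension_graph.mpr ⟨?_, ?_⟩
  · exact mem_relationStabilizer_adjoint_graph hd hSJ sJ _ _
      (mem_relationStabilizer_adjoint_graph hd hSP hP.isSelfAdjoint _ _ hgk)
  · simp only [hPJP]
    exact S.graph.zero_mem

theorem isJSelfAdjoint_mixedExtension (hS : IsClosedSymmetric S) (hJ : IsFundamentalSymmetry J)
    (hP : IsStarProjection P) (hSJ : J ∈ relationStabilizer S.graph)
    (hSP : P ∈ relationStabilizer S.graph) (hJP : J * P = (1 - P) * J) :
    IsJSelfAdjoint J (mixedExtension S P) := by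
  obtain ⟨hc, hd, hsymm⟩ := hS
  have hle := le_mixedExtension hd hsymm hSP
  have hJJ (v : H) : J (J v) = v := DFunLike.congr_fun hJ.1 v
  refine isJSelfAdjoint_iff.mpr ⟨hd.mono hle.1, fun x z => ⟨fun hxz y w hyw =>
    kreinInner_eq_of_mem_mixedExtension_graph hd hJ.2 hP.isSelfAdjoint hSJ hJP hxz hyw,
    fun h => mem_mixedExtension_graph.mpr ⟨?_, ?_⟩⟩⟩
  · rw [LinearPMap.adjoint_graph_eq_graph_adjoint hd, Submodule.mem_adjoint_iff]
    intro a b hab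
    have hpair := h _ _ (LinearPMap.le_graph_of_le hle (hSJ _ _ hab))
    rwa [hJJ, hJJ, ← sub_eq_zero] at hpair
  · rw [← adjoint_adjoint_of_isClosed hc, ← LinearPMap.adjoint_graph_eq_graph_adjoint hd,
      Submodule.mem_adjoint_iff]
    intro g k hgk
    have hpair := h _ _ (interchanged_mem_mixedExtension_graph hd hJ.2 hP hSJ hSP hJP hgk)
    have hPsymm (u v : H) : ⟪P u, v⟫_ℂ = ⟪u, P v⟫_ℂ := hP.isSelfAdjoint.isSymmetric u v
    rwa [hJJ, hJJ, hPsymm, hPsymm, ← sub_eq_zero] at hpair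

theorem pointSpectrum_adjoint_subset_mixedExtension (hd : Dense (S.domain : Set H))
    (hJ : IsFundamentalSymmetry J) (hP : IsStarProjection P)
    (hSJ : J ∈ relationStabilizer S.graph) (hSP : P ∈ relationStabilizer S.graph)
    (hJP : J * P = (1 - P) * J) :
    pointSpectrum S.adjoint ⊆ pointSpectrum (mixedExtension S P) := by
  rintro μ ⟨f, hf0, hf⟩
  have hJJ (v : H) : J (J v) = v := DFunLike.congr_fun hJ.1 v
  by_cases hPf : P f = 0
  · refine ⟨f, hf0, mem_mixedExtension_graph.mpr ⟨hf, ?_⟩⟩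
    simp only [map_smul, hPf, smul_zero]
    exact S.graph.zero_mem
  · refine ⟨J (P f), fun h => hPf ?_, ?_⟩
    · rw [← hJJ (P f), h, map_zero]
    · simpa only [map_smul] using
        interchanged_mem_mixedExtension_graph hd hJ.2 hP hSJ hSP hJP hf

end Extension

end KreinExt

theorem corollary4p2_general {H : Type*} [NormedAddCommGroup H] [InnerProductSpace ℂ H]
    [CompleteSpace H] (S : H →ₗ.[ℂ] H) (hS : KreinExt.IsClosedSymmetric S)
    (hSA : ¬IsSelfAdjoint S) (J R : H →L[ℂ] H)
    (hJ : KreinExt.IsFundamentalSymmetry J) (hR : KreinExt.IsFundamentalSymmetry R)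
    (hSJ : KreinExt.CommutesWith S J) (hSR : KreinExt.CommutesWith S R)
    (hJR : J * R = -(R * J))
    (J' : H →L[ℂ] H) (hJ' : J' ∈ KreinExt.cliffordSpan J R)
    (hJ'sym : KreinExt.IsNontrivialFundamentalSymmetry J') :
    ∃ A : H →ₗ.[ℂ] H, S ≤ A ∧ KreinExt.IsJSelfAdjoint J' A ∧ KreinExt.resolventSet A = ∅ := by
  obtain ⟨hJ'fund, hJ'ne, hJ'ne'⟩ := hJ'sym
  obtain ⟨P, hPspan, hP, hJ'P⟩ := KreinExt.exists_interchanged_projection hJ.1 hR.1 hJ.2 hR.2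
    hJR hJ' hJ'fund.1 hJ'fund.2 hJ'ne hJ'ne'
  have hSJ' := KreinExt.cliffordSpan_le_relationStabilizer hSJ hSR hJ'
  have hSP := KreinExt.cliffordSpan_le_relationStabilizer hSJ hSR hPspan
  have hA := KreinExt.isJSelfAdjoint_mixedExtension hS hJ'fund hP hSJ' hSP hJ'P
  have hspec := KreinExt.pointSpectrum_adjoint_subset_mixedExtension hS.2.1 hJ'fund hP hSJ' hSP hJ'P
  refine ⟨KreinExt.mixedExtension S P, KreinExt.le_mixedExtension hS.2.1 hS.2.2 hSP, hA,
    hA.resolventSet_eq_empty hJ'fund.1 fun μ hμ => ?_⟩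
  by_contra! hnot
  exact hSA (KreinExt.isSelfAdjoint_of_notMem_pointSpectrum_adjoint hS hμ
    (fun h => hnot.1 (hspec h)) fun h => hnot.2 (hspec h))

theorem corollary4p2 {H : Type*} [NormedAddCommGroup H] [InnerProductSpace ℂ H] [CompleteSpace H]
    (S : H →ₗ.[ℂ] H) (hS : KreinExt.IsClosedSymmetric S)
    (hdef : KreinExt.HasDeficiencyIndices S 2 2)
    (J R : H →L[ℂ] H)
    (hJ : KreinExt.IsFundamentalSymmetry J) (hR : KreinExt.IsFundamentalSymmetry R)
    (hSJ : KreinExt.CommutesWith S J) (hSR : KreinExt.CommutesWith S R)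
    (hJR : J * R = -(R * J))
    (J' : H →L[ℂ] H) (hJ' : J' ∈ KreinExt.cliffordSpan J R)
    (hJ'sym : KreinExt.IsNontrivialFundamentalSymmetry J') :
    ∃ A : H →ₗ.[ℂ] H, S ≤ A ∧ KreinExt.IsJSelfAdjoint J' A ∧ KreinExt.resolventSet A = ∅ :=
  corollary4p2_general S hS (hdef.not_isSelfAdjoint (.inl two_ne_zero)) J R hJ hR hSJ hSR hJR J' hJ'
    hJ'sym
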